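/- Let $L$ be a first-order language, let $T$ be a complete (in particular consistent) $L$-theory having a model with at least two elements, let $\kappa\ge 1$ be a cardinal and $k\ge 1$ an integer. A $(\kappa,k)$-function structure $(P,M;(f_i)_{i<\kappa})$ consists of two sorts $P,M$ and functions $f_i\colon P^k\to M$. An embedding of such structures is a pair of injections, one on each sort, commuting with the functions. For finite $\kappa$ the structure is called rich if, for every finite $(\kappa,k)$-function structure $(X,Y;(\sigma_i)_{i<\kappa})$ and every $X^*\subseteq X$, each embedding of $(X^*,Y;(\sigma_i)_{i<\kappa})$ into $(P,M;(f_i)_{i<\kappa})$ extends to an embedding of $(X,Y;(\sigma_i)_{i<\kappa})$. For arbitrary $\kappa$ it is called rich if $(P,M;(f_i)_{i\in I})$ is rich for every finite $I\subseteq\kappa$. Let $L^\kappa_k$ be the two-sorted language of the structures $(P,\mathcal M,(f_i)_{i<\kappa})$, where $P$ is a set, $\mathcal M$ is an $L$-structure with universe $M$, and each $f_i$ is a function $P^k\to M$. Let $D^\kappa_k(T)_{\_}$ be the $L^\kappa_k$-theory of all such structures with $P$ infinite and $\mathcal M\models T$. Let $D^\kappa_k(T)$ be the $L^\kappa_k$-theory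 of those that in addition have $(f_i)_{i<\kappa}$ rich. Then the following hold. (0) The models of $D^\kappa_k(T)_{\_}$ are exactly the structures $(P,\mathcal M,(f_i)_{i<\kappa})$ with $P$ infinite and $\mathcal M\models T$, and the models of $D^\kappa_k(T)$ are exactly those among them with $(f_i)_{i<\kappa}$ rich. (1) If $T$ has quantifier elimination, then $D^\kappa_k(T)$ is the model companion of $D^\kappa_k(T)_{\_}$ (that is, every embedding between models of $D^\kappa_k(T)$ is elementary, and every model of either theory embeds into a model of the other), $D^\kappa_k(T)$ is complete, and $D^\kappa_k(T)$ has quantifier elimination. (2) For arbitrary $T$ (as above, without assuming quantifier elimination), $D^\kappa_k(T)$ is complete, and every $L^\kappa_k$-formula $\phi(x_1,\ldots,x_n,y_1,\ldots,y_m)$, with the $x_i$ variables of sort $P$ and the $y_j$ variables of sort $M$, is equivalent modulo $D^\kappa_k(T)$ to a Boolean combination of equalities $x_i=x_j$ and formulas of the form $$\vartheta\bigl(g_1(x_{i_{1,1}},\ldots,x_{i_{1,k}}),\ldots,g_d(x_{i_{d,1}},\ldots,x_{i_{d,k}}),y_1,\ldots,y_m\bigr),$$ where $d \ge 0$, $\vartheta(z_1,\ldots,z_{d+m})$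 is an $L$-formula, each $g_j$ is one of the functions $f_i$ ($i<\kappa$), and the indices $i_{j,l}$ are in $\{1,\ldots,n\}$. (3) If $\eta$ is an embedding between models of $D^\kappa_k(T)$ such that the induced embedding of $L$-structures is elementary, then $\eta$ is elementary. -/

import Mathlib

open FirstOrder

universe u v w x

/-!
Two-sorted first-order logic for structures `(P, 𝓜, (f_i)_{i ∈ ι})`, where `P` is a set, `𝓜` is an
`L`-structure with universe `M`, and every `f_i` is a function `P ^ k → M`. The cardinal `κ` is
represented by an index type `ι` of cardinality `κ`.
-/

namespace GenericFunctions

/-- Terms of sort `M` in `n` variables of sort `P` and `m` variables of sort `M`. No symbol of the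
language takes values in `P`, so that the terms of sort `P` are exactly the variables of sort `P`;
hence the function symbol `f_i` is applied to `k` variables of sort `P`. -/
inductive Term (L : FirstOrder.Language.{u, v}) (ι : Type w) (k n m : ℕ) : Type (max u w)
  /-- a variable of sort `M` -/
  | var (j : Fin m) : Term L ι k n m
  /-- the term `f_i (x_{t 1}, …, x_{t k})` -/
  | app (i : ι) (t : Fin k → Fin n) : Term L ι k n m
  /-- a function symbol (or constant symbol) of `L` applied to terms of sort `M` -/
  | func {l : ℕ} (g : L.Functions l) (ts : Fin l → Term L ι k n m) : Term L ι k n m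

/-- First-order formulas of the two-sorted language whose free variables are among `n` variables of
sort `P` and `m` variables of sort `M`. A quantifier binds the last variable of its sort. -/
inductive Formula (L : FirstOrder.Language.{u, v}) (ι : Type w) (k : ℕ) : ℕ → ℕ → Type (max u v w)
  | falsum {n m : ℕ} : Formula L ι k n m
  /-- equality in the sort `P` -/
  | eqP {n m : ℕ} (i j : Fin n) : Formula L ι k n m
  /-- equality in the sort `M` -/
  | eqM {n m : ℕ} (s t : Term L ι k n m) : Formula L ι k n m
  | rel {n m l : ℕ} (R : L.Relations l) (ts : Fin l → Term L ι k n m) : Formula L ι k n m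
  | imp {n m : ℕ} (φ ψ : Formula L ι k n m) : Formula L ι k n m
  /-- universal quantification over the sort `P` -/
  | allP {n m : ℕ} (φ : Formula L ι k (n + 1) m) : Formula L ι k n m
  /-- universal quantification over the sort `M` -/
  | allM {n m : ℕ} (φ : Formula L ι k n (m + 1)) : Formula L ι k n m

/-- Sentences are formulas without free variables. -/
abbrev Sentence (L : FirstOrder.Language.{u, v}) (ι : Type w) (k : ℕ) := Formula L ι k 0 0

/-- A two-sorted structure `(P, 𝓜, (f_i)_{i ∈ ι})` with non-empty sorts. -/
structure Struct (L : FirstOrder.Language.{u, v}) (ι : Type w) (k : ℕ) where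
  P : Type x
  M : Type x
  [nonemptyP : Nonempty P]
  [nonemptyM : Nonempty M]
  [str : L.Structure M]
  f : ι → (Fin k → P) → M

attribute [instance] Struct.nonemptyP Struct.nonemptyM Struct.str

section Semantics

variable {L : FirstOrder.Language.{u, v}} {ι : Type w} {k : ℕ}

/-- The value of a term at `a` (for the `P`-variables) and `b` (for the `M`-variables). -/
def Term.realize (N : Struct.{u, v, w, x} L ι k) {n m : ℕ} (a : Fin n → N.P) (b : Fin m → N.M) :
    Term L ι k n m → N.M
  | .var j => b j
  | .app i t => N.f i (fun r => a (t r))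
  | .func g ts => FirstOrder.Language.Structure.funMap g (fun r => (ts r).realize N a b)

/-- Satisfaction of a formula in a structure. -/
def Formula.Realize (N : Struct.{u, v, w, x} L ι k) :
    {n m : ℕ} → Formula L ι k n m → (Fin n → N.P) → (Fin m → N.M) → Prop
  | _, _, .falsum, _, _ => False
  | _, _, .eqP i j, a, _ => a i = a j
  | _, _, .eqM s t, a, b => s.realize N a b = t.realize N a b
  | _, _, .rel R ts, a, b => FirstOrder.Language.Structure.RelMap R (fun r => (ts r).realize N a b)
  | _, _, .imp φ ψ, a, b => φ.Realize N a b → ψ.Realize N a b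
  | _, _, .allP φ, a, b => ∀ p : N.P, φ.Realize N (Fin.snoc a p) b
  | _, _, .allM φ, a, b => ∀ c : N.M, φ.Realize N a (Fin.snoc b c)

/-- The quantifier-free formulas. -/
inductive Formula.IsQF : {n m : ℕ} → Formula L ι k n m → Prop
  | falsum {n m : ℕ} : IsQF (Formula.falsum : Formula L ι k n m)
  | eqP {n m : ℕ} (i j : Fin n) : IsQF (Formula.eqP i j : Formula L ι k n m)
  | eqM {n m : ℕ} (s t : Term L ι k n m) : IsQF (Formula.eqM s t)
  | rel {n m l : ℕ} (R : L.Relations l) (ts : Fin l → Term L ι k n m) : IsQF (Formula.rel R ts)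
  | imp {n m : ℕ} {φ ψ : Formula L ι k n m} : IsQF φ → IsQF ψ → IsQF (Formula.imp φ ψ)

/-- `N` is a model of the set of sentences `Θ`. -/
def Models (N : Struct.{u, v, w, x} L ι k) (Θ : Set (Sentence L ι k)) : Prop :=
  ∀ φ ∈ Θ, φ.Realize N Fin.elim0 Fin.elim0

/-- The theory of a class `K` of structures: the sentences that hold in every member of `K`. -/
def theoryOf (K : Struct.{u, v, w, x} L ι k → Prop) : Set (Sentence L ι k) :=
  {φ | ∀ N, K N → φ.Realize N Fin.elim0 Fin.elim0}

/-- `φ` and `ψ` are equivalent modulo `Θ`: they define the same set in every model of `Θ`. -/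
def EquivModulo (Θ : Set (Sentence L ι k)) {n m : ℕ} (φ ψ : Formula L ι k n m) : Prop :=
  ∀ N : Struct.{u, v, w, max u v w} L ι k, Models N Θ →
    ∀ (a : Fin n → N.P) (b : Fin m → N.M), φ.Realize N a b ↔ ψ.Realize N a b

/-- `Θ` is consistent, and it implies every sentence or its negation. -/
def IsComplete (Θ : Set (Sentence L ι k)) : Prop :=
  (∃ N : Struct.{u, v, w, max u v w} L ι k, Models N Θ) ∧
  ∀ φ : Sentence L ι k,
    (∀ N : Struct.{u, v, w, max u v w} L ι k, Models N Θ → φ.Realize N Fin.elim0 Fin.elim0) ∨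
    (∀ N : Struct.{u, v, w, max u v w} L ι k, Models N Θ → ¬ φ.Realize N Fin.elim0 Fin.elim0)

/-- Every formula is equivalent modulo `Θ` to a quantifier-free formula in the same variables. -/
def HasQE (Θ : Set (Sentence L ι k)) : Prop :=
  ∀ (n m : ℕ) (φ : Formula L ι k n m), ∃ ψ : Formula L ι k n m, ψ.IsQF ∧ EquivModulo Θ φ ψ

/-- Embeddings of two-sorted structures: injective on both sorts, preserving the functions `f_i` and
the functions of `L`, and preserving and reflecting the relations of `L`. -/
structure Embedding (A B : Struct.{u, v, w, x} L ι k) where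
  toP : A.P ↪ B.P
  toM : A.M ↪[L] B.M
  map_f : ∀ (i : ι) (p : Fin k → A.P), toM (A.f i p) = B.f i (fun r => toP (p r))

/-- The embedding `η` preserves and reflects all formulas of the two-sorted language. -/
def Embedding.IsElementary {A B : Struct.{u, v, w, x} L ι k} (η : Embedding A B) : Prop :=
  ∀ (n m : ℕ) (φ : Formula L ι k n m) (a : Fin n → A.P) (b : Fin m → A.M),
    φ.Realize A a b ↔ φ.Realize B (fun i => η.toP (a i)) (fun j => η.toM (b j))

/-- Every embedding between models of `Θ` is elementary. -/
def IsModelComplete (Θ : Set (Sentence L ι k)) : Prop :=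
  ∀ A B : Struct.{u, v, w, max u v w} L ι k, Models A Θ → Models B Θ →
    ∀ η : Embedding A B, η.IsElementary

/-- `Θ'` is a model companion of `Θ`: it is model complete, every model of `Θ` embeds into a model
of `Θ'`, and every model of `Θ'` embeds into a model of `Θ`. -/
def IsModelCompanion (Θ' Θ : Set (Sentence L ι k)) : Prop :=
  IsModelComplete Θ' ∧
  (∀ A : Struct.{u, v, w, max u v w} L ι k, Models A Θ →
    ∃ B : Struct.{u, v, w, max u v w} L ι k, Models B Θ' ∧ Nonempty (Embedding A B)) ∧
  (∀ A : Struct.{u, v, w, max u v w} L ι k, Models A Θ' →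
    ∃ B : Struct.{u, v, w, max u v w} L ι k, Models B Θ ∧ Nonempty (Embedding A B))

end Semantics

section Rich

/-- `(a, b)` is an embedding of the function structure `(X, Y; σ)` into `(P, M; f)`. -/
def IsFunEmbedding {ι X Y P M : Type*} {k : ℕ} (σ : ι → (Fin k → X) → Y)
    (f : ι → (Fin k → P) → M) (a : X → P) (b : Y → M) : Prop :=
  Function.Injective a ∧ Function.Injective b ∧
    ∀ (i : ι) (t : Fin k → X), b (σ i t) = f i (fun r => a (t r))

/-- Richness of a function structure with finitely many functions: for every finite function
structure `(X, Y; σ)` and every `X' ⊆ X`, every embedding of `(X', Y; σ)` into `(P, M; f)` extends to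
an embedding of `(X, Y; σ)` into `(P, M; f)`. -/
def IsRichFinite {ι P M : Type*} {k : ℕ} (f : ι → (Fin k → P) → M) : Prop :=
  ∀ (X Y : Type) [Finite X] [Finite Y] (σ : ι → (Fin k → X) → Y) (X' : Set X)
    (a : X' → P) (b : Y → M),
    IsFunEmbedding (fun i (t : Fin k → X') => σ i (fun r => (t r : X))) f a b →
      ∃ a' : X → P, (∀ p : X', a' p = a p) ∧ IsFunEmbedding σ f a' b

/-- A function structure is rich if each of its reducts to finitely many functions is rich. -/
def IsRich {ι P M : Type*} {k : ℕ} (f : ι → (Fin k → P) → M) : Prop :=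
  ∀ I : Finset ι, IsRichFinite (fun i : I => f i)

end Rich

section Theories

variable {L : FirstOrder.Language.{u, v}}

/-- The structures `(P, 𝓜, (f_i))` with `P` infinite and `𝓜 ⊨ T`. -/
def IsFunStruct (T : L.Theory) {ι : Type w} {k : ℕ} (N : Struct.{u, v, w, x} L ι k) : Prop :=
  Infinite N.P ∧ N.M ⊨ T

/-- The theory of the structures `(P, 𝓜, (f_i))` with `P` infinite and `𝓜 ⊨ T`. -/
def DMinus (T : L.Theory) (ι : Type w) (k : ℕ) : Set (Sentence L ι k) :=
  theoryOf (fun N : Struct.{u, v, w, max u v w} L ι k => IsFunStruct T N)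

/-- The theory of the structures `(P, 𝓜, (f_i))` with `P` infinite, `𝓜 ⊨ T` and `(f_i)` rich. -/
def D (T : L.Theory) (ι : Type w) (k : ℕ) : Set (Sentence L ι k) :=
  theoryOf (fun N : Struct.{u, v, w, max u v w} L ι k => IsFunStruct T N ∧ IsRich N.f)

/-- Quantifier elimination for a (one-sorted) `L`-theory. -/
def TheoryHasQE (T : L.Theory) : Prop :=
  ∀ (n : ℕ) (φ : L.Formula (Fin n)), ∃ ψ : L.Formula (Fin n),
    FirstOrder.Language.BoundedFormula.IsQF ψ ∧ T.Iff φ ψ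

end Theories

section Reduced

variable {L : FirstOrder.Language.{u, v}} {ι : Type w} {k : ℕ}

/-- The `L`-term `t(z, y, q)` with `z_j` replaced by `f_{s j}(x_{e j 1}, …, x_{e j k})`. The bound
variables `q` become the `M`-variables that follow `y_1, …, y_m`. -/
def substTerm {n m d l : ℕ} (s : Fin d → ι) (e : Fin d → Fin k → Fin n) :
    L.Term ((Fin d ⊕ Fin m) ⊕ Fin l) → Term L ι k n (m + l)
  | .var (.inl (.inl j)) => .app (s j) (e j)
  | .var (.inl (.inr j)) => .var (Fin.castAdd l j)
  | .var (.inr j) => .var (Fin.natAdd m j)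
  | .func g ts => .func g (fun r => substTerm s e (ts r))

/-- The two-sorted formula
`ϑ (f_{s 1}(x_{e 1 1}, …, x_{e 1 k}), …, f_{s d}(x_{e d 1}, …, x_{e d k}), y_1, …, y_m)`,
where `ϑ` is an `L`-formula in `d + m` free variables (and `l` variables that are bound further
outside; `l = 0` for a formula proper). -/
def substFormula {n m d : ℕ} (s : Fin d → ι) (e : Fin d → Fin k → Fin n) :
    {l : ℕ} → L.BoundedFormula (Fin d ⊕ Fin m) l → Formula L ι k n (m + l)
  | _, .falsum => .falsum
  | _, .equal t₁ t₂ => .eqM (substTerm s e t₁) (substTerm s e t₂)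
  | _, .rel R ts => .rel R (fun r => substTerm s e (ts r))
  | _, .imp φ ψ => .imp (substFormula s e φ) (substFormula s e ψ)
  | _, .all φ => .allM (substFormula (m := m) s e φ)

/-- Boolean combinations of equalities `x_i = x_j` between variables of sort `P` and of formulas
`ϑ (f_{s 1}(x_{e 1 1}, …, x_{e 1 k}), …, f_{s d}(x_{e d 1}, …, x_{e d k}), y_1, …, y_m)` with `ϑ` an
`L`-formula. -/
inductive IsReduced {n m : ℕ} : Formula L ι k n m → Prop
  | falsum : IsReduced Formula.falsum
  | eqP (i j : Fin n) : IsReduced (Formula.eqP i j)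
  | subst {d : ℕ} (s : Fin d → ι) (e : Fin d → Fin k → Fin n) (θ : L.Formula (Fin d ⊕ Fin m)) :
      IsReduced (substFormula s e θ)
  | imp {φ ψ : Formula L ι k n m} : IsReduced φ → IsReduced ψ → IsReduced (Formula.imp φ ψ)

end Reduced

end GenericFunctions

/-! Richness amounts to a one-point extension property: given finitely many distinct points of `P`
and finitely many of the functions, a new point exists whose values at all tuples involving it are
prescribed elements of `M`. In this form it is first-order: the prescribed values are universally
quantified variables of sort `M`.

The heart is `exists_elimination`. At a tuple of distinct points, every formula is equivalent to an
`L`-formula in the values of the functions there. Only a quantifier over `P` needs an argument. The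
point `p` is either one of the given points or new, and as it ranges over the new points, the values
at tuples through `p` that the formula mentions range over all families of elements of `M`.
Quantifying over new points thus becomes quantifying over `M`. A case distinction on which variables
coincide then gives the reduced form.

Everything else follows. Reduced formulas are preserved in both directions by embeddings that are
elementary on `M`; quantifier elimination for `T` makes the `L`-formulas quantifier-free; and a
sentence has no points to evaluate at, since `k ≥ 1`, so it becomes an `L`-sentence, which the
complete theory `T` decides. Models of `D` are built by freely adding points to `P` while leaving
`M` unchanged (`RichExtension`). -/

namespace GenericFunctions

/-! ### Richness as a one-point extension property -/

section OnePoint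

/-- The one-point extension property: over finitely many distinct points of `P`, the values of
finitely many functions at the tuples that contain a new point can be prescribed. -/
def OnePointExtension {ι P M : Type*} {k : ℕ} (f : ι → (Fin k → P) → M) : Prop :=
  ∀ (I : Finset ι) (n : ℕ) (a : Fin n → P), Function.Injective a →
    ∀ w : ι → (Fin k → Fin (n + 1)) → M, ∃ p : P, (∀ j, a j ≠ p) ∧
      ∀ i ∈ I, ∀ e : Fin k → Fin (n + 1), (∃ r, e r = Fin.last n) →
        f i (fun r => (Fin.snoc a p : Fin (n + 1) → P) (e r)) = w i e

variable {ι P M : Type*} {k : ℕ} {f : ι → (Fin k → P) → M}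

theorem IsRich.onePointExtension (hf : IsRich f) : OnePointExtension f := by
  classical
  intro I n a ha w
  have hlt {r : Fin (n + 1)} (h : r ≠ Fin.last n) : (r : ℕ) < n := Fin.val_lt_last h
  -- Tuples of old points keep their values under `f`, so that the old points embed by `a`.
  let W : ι → (Fin k → Fin (n + 1)) → M := fun i e =>
    if h : ∃ r, e r = Fin.last n then w i e
    else f i (fun r => a ⟨e r, hlt fun h' => h ⟨r, h'⟩⟩)
  -- The sort `Y` consists of all values that occur, coded as `Fin m` because richness tests
  -- structures in `Type`.
  let S : Set M := Set.range fun x : I × (Fin k → Fin (n + 1)) => W x.1 x.2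
  obtain ⟨m, ⟨eqv⟩⟩ := Finite.exists_equiv_fin S
  let X' : Set (Fin (n + 1)) := {r | r ≠ Fin.last n}
  obtain ⟨a', ha', hinj, -, hval⟩ := hf I (Fin (n + 1)) (Fin m)
    (fun i e => eqv ⟨W i e, (i, e), rfl⟩) X' (fun r => a ⟨r.1, hlt r.2⟩)
    (fun y => (eqv.symm y).1) ⟨fun r s h => by
        have := ha h
        exact Subtype.ext (Fin.ext (by simpa using this)),
      Subtype.val_injective.comp eqv.symm.injective, fun i t => by
        have : ¬ ∃ r, (t r : Fin (n + 1)) = Fin.last n := fun ⟨r, h⟩ => (t r).2 h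
        simp [W, this]⟩
  have hcast (j : Fin n) : a' j.castSucc = a j := ha' ⟨j.castSucc, Fin.castSucc_ne_last j⟩
  have hsnoc : (Fin.snoc a (a' (Fin.last n)) : Fin (n + 1) → P) = a' := by
    funext r
    refine Fin.lastCases ?_ (fun j => ?_) r
    · simp
    · simp [hcast]
  refine ⟨a' (Fin.last n), fun j h => ?_, fun i hi e he => ?_⟩
  · rw [← hcast] at h
    exact Fin.castSucc_ne_last j (hinj h)
  · rw [hsnoc]
    refine (hval ⟨i, hi⟩ e).symm.trans ?_
    simp [W, he]

/-- The points of the finite set `X` outside `X'` are added one at a time; the values involving each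
new point are those dictated by `σ`. -/
theorem OnePointExtension.isRich [Nonempty P] (hf : OnePointExtension f) : IsRich f := by
  classical
  intro I X Y _ _ σ X' a b hab
  obtain ⟨ha, hb, hσ⟩ := hab
  have key : ∀ Z : Finset X, ∃ a' : X → P, (∀ p : X', a' p = a p) ∧
      Set.InjOn a' (X' ∪ Z) ∧ ∀ (i : I) (t : Fin k → X), (∀ r, t r ∈ X' ∪ (Z : Set X)) →
        b (σ i t) = f i (fun r => a' (t r)) := by
    intro Z
    induction Z using Finset.induction_on with
    | empty =>
      refine ⟨fun p => if h : p ∈ X' then a ⟨p, h⟩ else Classical.arbitrary P,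
        fun p => by simp, ?_, ?_⟩
      · intro p hp q hq h
        have hp' : p ∈ X' := by simpa using hp
        have hq' : q ∈ X' := by simpa using hq
        exact congrArg Subtype.val (ha (a₁ := ⟨p, hp'⟩) (a₂ := ⟨q, hq'⟩)
          (by simpa [hp', hq'] using h))
      · intro i t ht
        have ht' : ∀ r, t r ∈ X' := fun r => by simpa using ht r
        simpa [ht'] using hσ i (fun r => ⟨t r, ht' r⟩)
    | insert z Z _ ih =>
      obtain ⟨a', h1, h2, h3⟩ := ih
      by_cases hz : z ∈ X' ∪ (Z : Set X)
      · refine ⟨a', h1, ?_⟩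
        have : X' ∪ ((insert z Z : Finset X) : Set X) = X' ∪ (Z : Set X) := by
          rw [Finset.coe_insert, Set.union_insert, Set.insert_eq_of_mem hz]
        rw [this]
        exact ⟨h2, h3⟩
      · obtain ⟨n, ⟨eqv⟩⟩ := Finite.exists_equiv_fin (X' ∪ (Z : Set X) : Set X)
        let c : Fin (n + 1) → X := Fin.snoc (fun j => (eqv.symm j).1) z
        obtain ⟨p, hp, hv⟩ := hf I n (fun j => a' (eqv.symm j).1)
          (fun j l h => eqv.symm.injective (Subtype.ext
            (h2 (eqv.symm j).2 (eqv.symm l).2 h)))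
          (fun i e => if hi : i ∈ I then b (σ ⟨i, hi⟩ (fun r => c (e r)))
            else f i (fun _ => Classical.arbitrary P))
        have hne {q : X} (hq : q ∈ X' ∪ (Z : Set X)) : q ≠ z := fun h => hz (h ▸ hq)
        have hp' {q : X} (hq : q ∈ X' ∪ (Z : Set X)) : a' q ≠ p := by
          simpa using hp (eqv ⟨q, hq⟩)
        have hu : X' ∪ ((insert z Z : Finset X) : Set X) = insert z (X' ∪ (Z : Set X)) := by
          rw [Finset.coe_insert, Set.union_insert]
        refine ⟨Function.update a' z p, fun q => ?_, ?_, ?_⟩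
        · rw [Function.update_of_ne (hne (Or.inl q.2)), h1]
        · rw [hu]
          rintro q (rfl | hq) q' (rfl | hq') h
          · rfl
          · rw [Function.update_self, Function.update_of_ne (hne hq')] at h
            exact absurd h.symm (hp' hq')
          · rw [Function.update_self, Function.update_of_ne (hne hq)] at h
            exact absurd h (hp' hq)
          · rw [Function.update_of_ne (hne hq), Function.update_of_ne (hne hq')] at h
            exact h2 hq hq' h
        · intro i t ht
          rw [hu] at ht
          by_cases hzt : ∃ r, t r = z
          -- The positions of the entries of `t` in the enumeration `c`, whose last entry is `z`.
          · let e : Fin k → Fin (n + 1) := fun r =>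
              if h : t r ∈ X' ∪ (Z : Set X) then (eqv ⟨t r, h⟩).castSucc else Fin.last n
            have hce : (fun r => c (e r)) = t := by
              funext r
              by_cases h : t r ∈ X' ∪ (Z : Set X)
              · simp only [e, c, dif_pos h, Fin.snoc_castSucc, Equiv.symm_apply_apply]
              · simp only [e, c, dif_neg h, Fin.snoc_last]
                exact ((ht r).resolve_right h).symm
            have := hv i i.2 e (by
              obtain ⟨r, hr⟩ := hzt
              exact ⟨r, by simp only [e]; rw [dif_neg (hr ▸ hz)]⟩)
            rw [dif_pos i.2, hce] at this
            rw [← this]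
            congr 1
            funext r
            by_cases h : t r ∈ X' ∪ (Z : Set X)
            · simp only [e, dif_pos h, Fin.snoc_castSucc, Equiv.symm_apply_apply]
              rw [Function.update_of_ne (hne h)]
            · simp only [e, dif_neg h, Fin.snoc_last]
              rw [(ht r).resolve_right h, Function.update_self]
          · have ht' : ∀ r, t r ∈ X' ∪ (Z : Set X) := fun r =>
              (ht r).resolve_left fun h => hzt ⟨r, h⟩
            rw [h3 i t ht']
            congr 1
            funext r
            rw [Function.update_of_ne (hne (ht' r))]
  have := Fintype.ofFinite X
  obtain ⟨a', h1, h2, h3⟩ := key Finset.univ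
  refine ⟨a', h1, fun p q h => h2 (by simp) (by simp) h, hb, fun i t => h3 i t (by simp)⟩

end OnePoint

/-! ### Free construction of rich structures -/

section RichExtension

/-- The points of a rich extension of a function structure on `P` and `M`: the points of `P` are
kept, and for all finite tuples of points and all prescribed values a new point is added. -/
inductive RichExtension (P M : Type x) (ι : Type w) (k : ℕ) : Type (max x w)
  | base (p : P) : RichExtension P M ι k
  | ext {n : ℕ} (a : Fin n → RichExtension P M ι k) (v : ι → (Fin k → Fin (n + 1)) → M) :
      RichExtension P M ι k

namespace RichExtension

variable {P M : Type x} {ι : Type w} {k : ℕ}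

/-- The depth in the free construction. -/
def rank : RichExtension P M ι k → ℕ
  | base _ => 0
  | ext a _ => (Finset.univ.sup fun j => (a j).rank) + 1

theorem rank_lt_ext {n : ℕ} (a : Fin n → RichExtension P M ι k)
    (v : ι → (Fin k → Fin (n + 1)) → M) (j : Fin n) : (a j).rank < (ext a v).rank := by
  rw [rank]
  exact Nat.lt_succ_of_le (Finset.le_sup (f := fun j => (a j).rank) (Finset.mem_univ j))

theorem ne_ext {n : ℕ} (a : Fin n → RichExtension P M ι k)
    (v : ι → (Fin k → Fin (n + 1)) → M) (j : Fin n) : a j ≠ ext a v := fun h =>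
  (rank_lt_ext a v j).ne (congrArg rank h)

/-- `t` is a tuple that contains the new point `ext a v` and otherwise points of `a` only, as
described by `e`. -/
def IsNew (t : Fin k → RichExtension P M ι k) {n : ℕ} (a : Fin n → RichExtension P M ι k)
    (v : ι → (Fin k → Fin (n + 1)) → M) (e : Fin k → Fin (n + 1)) : Prop :=
  (∃ r, e r = Fin.last n) ∧
    ∀ r, t r = (Fin.snoc a (ext a v) : Fin (n + 1) → RichExtension P M ι k) (e r)

theorem IsNew.rank_le {t : Fin k → RichExtension P M ι k} {n : ℕ}
    {a : Fin n → RichExtension P M ι k} {v : ι → (Fin k → Fin (n + 1)) → M}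
    {e : Fin k → Fin (n + 1)} (h : IsNew t a v e) (r : Fin k) :
    (t r).rank < (ext a v).rank ∨ t r = ext a v := by
  rw [h.2 r]
  refine Fin.lastCases ?_ (fun j => ?_) (e r)
  · simp
  · left
    rw [Fin.snoc_castSucc]
    exact rank_lt_ext a v j

theorem IsNew.exists_eq {t : Fin k → RichExtension P M ι k} {n : ℕ}
    {a : Fin n → RichExtension P M ι k} {v : ι → (Fin k → Fin (n + 1)) → M}
    {e : Fin k → Fin (n + 1)} (h : IsNew t a v e) : ∃ r, t r = ext a v := by
  obtain ⟨r, hr⟩ := h.1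
  exact ⟨r, by rw [h.2, hr, Fin.snoc_last]⟩

/-- A tuple determines its new point as its unique entry of maximal rank: both candidates occur in
`t`, and neither can have smaller rank than the other. -/
theorem IsNew.ext_eq {t : Fin k → RichExtension P M ι k} {n n' : ℕ}
    {a : Fin n → RichExtension P M ι k} {v : ι → (Fin k → Fin (n + 1)) → M}
    {e : Fin k → Fin (n + 1)} {a' : Fin n' → RichExtension P M ι k}
    {v' : ι → (Fin k → Fin (n' + 1)) → M} {e' : Fin k → Fin (n' + 1)}
    (h : IsNew t a v e) (h' : IsNew t a' v' e') : ext a v = ext a' v' := by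
  obtain ⟨r, hr⟩ := h.exists_eq
  obtain ⟨r', hr'⟩ := h'.exists_eq
  rcases h'.rank_le r with h1 | h1
  · rcases h.rank_le r' with h2 | h2
    · rw [hr] at h1
      rw [hr'] at h2
      omega
    · rw [← hr', h2]
  · rw [← hr, h1]

open Classical in
/-- The functions on the rich extension. -/
noncomputable def fn [Nonempty M] (f : ι → (Fin k → P) → M) (i : ι)
    (t : Fin k → RichExtension P M ι k) : M :=
  if h : ∃ q : Fin k → P, t = fun r => base (q r) then f i h.choose
  -- The choice is harmless: `fn_new` shows that at most one `m` qualifies.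
  else if h : ∃ m : M, ∃ (n : ℕ) (a : Fin n → RichExtension P M ι k)
      (v : ι → (Fin k → Fin (n + 1)) → M) (e : Fin k → Fin (n + 1)),
      Function.Injective a ∧ IsNew t a v e ∧ m = v i e then h.choose
  else Classical.arbitrary M

theorem fn_base [Nonempty M] (f : ι → (Fin k → P) → M) (i : ι) (q : Fin k → P) :
    fn f i (fun r => base (q r)) = f i q := by
  have h : ∃ q' : Fin k → P, (fun r => (base (q r) : RichExtension P M ι k)) =
      fun r => base (q' r) := ⟨q, rfl⟩
  rw [fn, dif_pos h]
  congr 1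
  funext r
  have := congrFun h.choose_spec r
  exact (RichExtension.base.inj this).symm

/-- By `IsNew.ext_eq` the tuple determines `ext a v`, hence `a` and `v` by injectivity of the
constructor; injectivity of `a` then determines `e`. -/
theorem fn_new [Nonempty M] (f : ι → (Fin k → P) → M) (i : ι) {t : Fin k → RichExtension P M ι k}
    {n : ℕ} {a : Fin n → RichExtension P M ι k} {v : ι → (Fin k → Fin (n + 1)) → M}
    {e : Fin k → Fin (n + 1)} (ha : Function.Injective a) (h : IsNew t a v e) :
    fn f i t = v i e := by
  have h0 : ¬ ∃ q : Fin k → P, t = fun r => base (q r) := by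
    rintro ⟨q, rfl⟩
    obtain ⟨r, hr⟩ := h.exists_eq
    cases hr
  have h1 : ∃ m : M, ∃ (n : ℕ) (a : Fin n → RichExtension P M ι k)
      (v : ι → (Fin k → Fin (n + 1)) → M) (e : Fin k → Fin (n + 1)),
      Function.Injective a ∧ IsNew t a v e ∧ m = v i e := ⟨_, n, a, v, e, ha, h, rfl⟩
  rw [fn, dif_neg h0, dif_pos h1]
  obtain ⟨n', a', v', e', -, h', hm⟩ := h1.choose_spec
  rw [hm]
  have hext := h.ext_eq h'
  injection hext with hn ha' hv'
  subst hn
  obtain rfl := eq_of_heq ha'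
  obtain rfl := eq_of_heq hv'
  congr 1
  funext r
  have hinj : Function.Injective
      (Fin.snoc a (ext a v) : Fin (n + 1) → RichExtension P M ι k) :=
    Fin.snoc_injective_iff.2 ⟨ha, fun ⟨j, hj⟩ => ne_ext a v j hj⟩
  exact hinj ((h'.2 r).symm.trans (h.2 r))

/-- The inductive type is already closed under adding points, so no chain of extensions is needed:
`ext a w` is the required witness. -/
theorem onePointExtension_fn [Nonempty M] (f : ι → (Fin k → P) → M) :
    OnePointExtension (fn f) := by
  intro I n a ha w
  exact ⟨ext a w, ne_ext a w, fun i _ e he => fn_new f i ha ⟨he, fun _ => rfl⟩⟩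

end RichExtension

end RichExtension

/-! ### Elimination of quantifiers over `P` -/

section Elimination

open FirstOrder.Language

variable {L : FirstOrder.Language.{u, v}}

theorem realize_congr_freeVarFinset {γ : Type*} [DecidableEq γ] (θ : L.Formula γ) {M : Type*}
    [L.Structure M] {v v' : γ → M}
    (h : ∀ c ∈ BoundedFormula.freeVarFinset θ, v c = v' c) : θ.Realize v ↔ θ.Realize v' := by
  let ψ := BoundedFormula.restrictFreeVar θ (id : _ → BoundedFormula.freeVarFinset θ)
  have h1 : BoundedFormula.Realize ψ (fun c => v c.1) default ↔ θ.Realize v :=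
    BoundedFormula.realize_restrictFreeVar v (fun _ => rfl)
  have h2 : BoundedFormula.Realize ψ (fun c => v c.1) default ↔ θ.Realize v' :=
    BoundedFormula.realize_restrictFreeVar v' (fun c => h c.1 c.2)
  exact h1.symm.trans h2

/-- A formula in the variables `α ⊕ β` only uses finitely many of the variables in `β`. -/
theorem exists_finite_inr {α β : Type*} (θ : L.Formula (α ⊕ β)) :
    ∃ (S : Finset β) (θ' : L.Formula (α ⊕ S)), ∀ (M : Type x) [L.Structure M] (a : α → M)
      (b : β → M), θ'.Realize (Sum.elim a fun c => b c) ↔ θ.Realize (Sum.elim a b) := by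
  classical
  let S : Finset β := (BoundedFormula.freeVarFinset θ).toRight
  let g : BoundedFormula.freeVarFinset θ → α ⊕ S := fun c => match c with
    | ⟨.inl c, _⟩ => .inl c
    | ⟨.inr c, hc⟩ => .inr ⟨c, Finset.mem_toRight.2 hc⟩
  refine ⟨S, BoundedFormula.restrictFreeVar θ g, fun M _ a b => ?_⟩
  refine BoundedFormula.realize_restrictFreeVar _ ?_
  rintro ⟨c | c, hc⟩ <;> rfl

/-- Universal quantification over an arbitrary family of variables. -/
theorem exists_forall_formula {α β : Type*} (θ : L.Formula (α ⊕ β)) :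
    ∃ θ' : L.Formula α, ∀ (M : Type x) [L.Structure M] [Nonempty M] (a : α → M),
      θ'.Realize a ↔ ∀ b : β → M, θ.Realize (Sum.elim a b) := by
  classical
  obtain ⟨S, θ₀, h⟩ := exists_finite_inr.{u, v, x} θ
  refine ⟨θ₀.iAlls S, fun M _ _ a => ?_⟩
  rw [Formula.realize_iAlls]
  constructor
  · intro H b
    exact (h M a b).1 (H _)
  · intro H c
    -- Variables outside `S` do not matter and get an arbitrary value.
    have := (h M a fun x => if hx : x ∈ S then c ⟨x, hx⟩ else Classical.arbitrary M).2 (H _)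
    simpa using this

variable {ι : Type w} {k : ℕ}

/-- The values of the functions at the tuples of points of `a`, followed by `b`. -/
def valuation (N : Struct.{u, v, w, x} L ι k) {n m : ℕ} (a : Fin n → N.P) (b : Fin m → N.M) :
    (ι × (Fin k → Fin n)) ⊕ Fin m → N.M :=
  Sum.elim (fun q => N.f q.1 fun r => a (q.2 r)) b

/-- Terms of the two-sorted language as terms of `L` in the values of the functions. -/
def Term.toL {n m n' : ℕ} (c : Fin n → Fin n') :
    Term L ι k n m → L.Term ((ι × (Fin k → Fin n')) ⊕ Fin m)
  | .var j => .var (.inr j)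
  | .app i t => .var (.inl (i, fun r => c (t r)))
  | .func g ts => .func g fun r => (ts r).toL c

theorem Term.realize_toL (N : Struct.{u, v, w, x} L ι k) {n m n' : ℕ} (c : Fin n → Fin n')
    (a : Fin n' → N.P) (b : Fin m → N.M) (t : Term L ι k n m) :
    (t.toL c).realize (valuation N a b) = t.realize N (fun j => a (c j)) b := by
  induction t with
  | var j => rfl
  | app i t => rfl
  | func g ts ih =>
    rw [Term.toL, Term.realize, FirstOrder.Language.Term.realize_func]
    simp only [ih]

/-- In structures with the one-point extension property, a formula at a tuple of distinct points
is equivalent to an `L`-formula in the values of the functions at these points. -/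
theorem exists_elimination {n m : ℕ} (φ : Formula L ι k n m) :
    ∀ {n' : ℕ} (c : Fin n → Fin n'), ∃ θ : L.Formula ((ι × (Fin k → Fin n')) ⊕ Fin m),
      ∀ N : Struct.{u, v, w, x} L ι k, OnePointExtension N.f →
        ∀ (a : Fin n' → N.P), Function.Injective a → ∀ b : Fin m → N.M,
          φ.Realize N (fun j => a (c j)) b ↔ θ.Realize (valuation N a b) := by
  classical
  -- The map `c` lets several variables name one point while `a` stays injective; it varies in the
  -- induction because quantifiers over `P` extend it.
  induction φ with
  | falsum => exact fun c => ⟨⊥, fun N _ a _ b => Iff.rfl⟩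
  | eqP i j =>
    intro n' c
    by_cases h : c i = c j
    · exact ⟨⊤, fun N _ a _ b => by simp [Formula.Realize, h]⟩
    · exact ⟨⊥, fun N _ a ha b => by simp [Formula.Realize, ha.eq_iff, h]⟩
  | eqM s t =>
    intro n' c
    refine ⟨(s.toL c).equal (t.toL c), fun N _ a _ b => ?_⟩
    rw [Formula.realize_equal, Term.realize_toL, Term.realize_toL]
    rfl
  | rel R ts =>
    intro n' c
    refine ⟨R.formula fun r => (ts r).toL c, fun N _ a _ b => ?_⟩
    rw [Formula.realize_rel]
    simp only [Term.realize_toL]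
    rfl
  | imp φ ψ ihφ ihψ =>
    intro n' c
    obtain ⟨θ₁, h₁⟩ := ihφ c
    obtain ⟨θ₂, h₂⟩ := ihψ c
    refine ⟨θ₁.imp θ₂, fun N hN a ha b => ?_⟩
    rw [Formula.realize_imp, ← h₁ N hN a ha b, ← h₂ N hN a ha b]
    rfl
  | @allM n m φ ih =>
    intro n' c
    obtain ⟨θ, h⟩ := ih c
    obtain ⟨θ', h'⟩ := exists_forall_formula.{u, v, x} (α := (ι × (Fin k → Fin n')) ⊕ Fin m)
      (β := Unit) (θ.relabel (Sum.elim (fun q => .inl (.inl q))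
        (Fin.snoc (α := fun _ => ((ι × (Fin k → Fin n')) ⊕ Fin m) ⊕ Unit)
          (fun j => .inl (.inr j)) (.inr ()))))
    refine ⟨θ', fun N hN a ha b => ?_⟩
    rw [h']
    have key (d : N.M) : φ.Realize N (fun j => a (c j)) (Fin.snoc b d) ↔
        (θ.relabel (Sum.elim (fun q => .inl (.inl q))
        (Fin.snoc (α := fun _ => ((ι × (Fin k → Fin n')) ⊕ Fin m) ⊕ Unit)
          (fun j => .inl (.inr j)) (.inr ())))).Realize
            (Sum.elim (valuation N a b) fun _ => d) := by
      rw [h N hN a ha, Formula.realize_relabel]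
      refine iff_of_eq (congrArg _ (funext ?_))
      rintro (q | j)
      · rfl
      · refine Fin.lastCases ?_ (fun j => ?_) j <;> simp [valuation]
    constructor
    · exact fun H d => (key (d ())).1 (H (d ()))
    · exact fun H d => (key d).2 (H fun _ => d)
  | @allP n m φ ih =>
    intro n' c
    -- `θ j` treats the case that the quantified point is `a j`, and `θ₀` the case that it is new.
    choose θ h using fun j : Fin n' => ih (Fin.snoc (α := fun _ => Fin n') c j)
    obtain ⟨θ₀, h₀⟩ := ih (Fin.snoc (α := fun _ => Fin (n' + 1)) (fun j => (c j).castSucc)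
      (Fin.last n'))
    -- Values at tuples through the new point become fresh variables of sort `M`; the others are
    -- values at the old points.
    let g : (ι × (Fin k → Fin (n' + 1))) ⊕ Fin m →
        ((ι × (Fin k → Fin n')) ⊕ Fin m) ⊕ (ι × (Fin k → Fin (n' + 1))) :=
      Sum.elim (fun q => if hq : ∃ r, q.2 r = Fin.last n' then .inr q
        else .inl (.inl (q.1, fun r => (q.2 r).castPred fun h' => hq ⟨r, h'⟩)))
        (fun j => .inl (.inr j))
    obtain ⟨θ₁, h₁⟩ := exists_forall_formula.{u, v, x} (θ₀.relabel g)
    refine ⟨BoundedFormula.iInf θ ⊓ θ₁, fun N hN a ha b => ?_⟩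
    rw [Formula.realize_inf, h₁]
    have hinf : FirstOrder.Language.Formula.Realize (BoundedFormula.iInf θ) (valuation N a b) ↔
        ∀ j, (θ j).Realize (valuation N a b) := BoundedFormula.realize_iInf
    have hval (p : N.P) (v : ι × (Fin k → Fin (n' + 1)) → N.M) (I : Finset ι)
        (hI : ∀ q : ι × (Fin k → Fin (n' + 1)),
          .inl q ∈ BoundedFormula.freeVarFinset θ₀ → q.1 ∈ I)
        (hv : ∀ i ∈ I, ∀ e : Fin k → Fin (n' + 1), (∃ r, e r = Fin.last n') →
          N.f i (fun r => (Fin.snoc a p : Fin (n' + 1) → N.P) (e r)) = v (i, e)) :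
        (θ₀.relabel g).Realize (Sum.elim (valuation N a b) v) ↔
          θ₀.Realize (valuation N (Fin.snoc a p : Fin (n' + 1) → N.P) b) := by
      rw [Formula.realize_relabel]
      refine realize_congr_freeVarFinset θ₀ ?_
      rintro (q | j) hq
      · by_cases hr : ∃ r, q.2 r = Fin.last n'
        · simp only [g, Function.comp_apply, Sum.elim_inl, dif_pos hr, Sum.elim_inr, valuation]
          exact (hv q.1 (hI q hq) q.2 hr).symm
        · simp only [g, Function.comp_apply, Sum.elim_inl, dif_neg hr, valuation]
          congr 1
          funext r
          conv_rhs => rw [← Fin.castSucc_castPred (q.2 r) fun h' => hr ⟨r, h'⟩]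
          rw [Fin.snoc_castSucc]
      · rfl
    have hold (j : Fin n') : φ.Realize N (Fin.snoc (fun l => a (c l)) (a j)) b ↔
        (θ j).Realize (valuation N a b) := by
      rw [← h j N hN a ha b]
      refine iff_of_eq (congrArg (fun z => φ.Realize N z b) (funext fun l => ?_))
      refine Fin.lastCases ?_ (fun l => ?_) l <;> simp
    have hnew (p : N.P) (hp : ∀ j, a j ≠ p) :
        φ.Realize N (Fin.snoc (fun l => a (c l)) p) b ↔
          θ₀.Realize (valuation N (Fin.snoc a p : Fin (n' + 1) → N.P) b) := by
      rw [← h₀ N hN _ (Fin.snoc_injective_iff.2 ⟨ha, fun ⟨j, hj⟩ => hp j hj⟩) b]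
      refine iff_of_eq (congrArg (fun z => φ.Realize N z b) (funext fun l => ?_))
      refine Fin.lastCases ?_ (fun l => ?_) l <;> simp
    -- Only the finitely many functions that occur in `θ₀` have to be controlled.
    let I : Finset ι := (BoundedFormula.freeVarFinset θ₀).toLeft.image Prod.fst
    have hI (q : ι × (Fin k → Fin (n' + 1)))
        (hq : .inl q ∈ BoundedFormula.freeVarFinset θ₀) : q.1 ∈ I :=
      Finset.mem_image_of_mem _ (Finset.mem_toLeft.2 hq)
    constructor
    · refine fun H => ⟨hinf.2 fun j => (hold j).1 (H (a j)), fun v => ?_⟩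
      -- Any family `v` is realized by a new point: this is where the extension property enters.
      obtain ⟨p, hp, hv⟩ := hN I n' a ha fun i e => v (i, e)
      exact (hval p v I hI hv).2 ((hnew p hp).1 (H p))
    · rintro ⟨H1, H2⟩ p
      by_cases hp : ∃ j, a j = p
      · obtain ⟨j, rfl⟩ := hp
        exact (hold j).2 (hinf.1 H1 j)
      · rw [not_exists] at hp
        exact (hnew p hp).2 ((hval p (fun q => N.f q.1 fun r =>
          (Fin.snoc a p : Fin (n' + 1) → N.P) (q.2 r)) I hI fun _ _ _ _ => rfl).1 (H2 _))

end Elimination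

/-! ### Derived connectives and substitution into `L`-formulas -/

section Connectives

variable {L : FirstOrder.Language.{u, v}} {ι : Type w} {k n m : ℕ}

namespace Formula

/-- Negation. -/
protected def not (φ : Formula L ι k n m) : Formula L ι k n m := .imp φ .falsum

/-- Conjunction. -/
protected def and (φ ψ : Formula L ι k n m) : Formula L ι k n m := (φ.imp ψ.not).not

/-- The conjunction of a list of formulas. -/
def conj (l : List (Formula L ι k n m)) : Formula L ι k n m :=
  l.foldr Formula.and (Formula.not .falsum)

/-- The conjunction of a finite family of formulas. -/
noncomputable def iInf {β : Type*} [Finite β] (φ : β → Formula L ι k n m) : Formula L ι k n m :=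
  letI := Fintype.ofFinite β
  conj (Finset.univ.toList.map φ)

/-- Existential quantification over the sort `P`. -/
def exP (φ : Formula L ι k (n + 1) m) : Formula L ι k n m := (allP φ.not).not

/-- Universal quantification over all variables of sort `P`. -/
def closeP : {n : ℕ} → Formula L ι k n m → Formula L ι k 0 m
  | 0, φ => φ
  | _ + 1, φ => closeP φ.allP

/-- Universal quantification over all variables of sort `M`. -/
def closeM : {m : ℕ} → Formula L ι k n m → Formula L ι k n 0
  | 0, φ => φ
  | _ + 1, φ => closeM φ.allM

variable (N : Struct.{u, v, w, x} L ι k) (a : Fin n → N.P) (b : Fin m → N.M)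

theorem realize_not (φ : Formula L ι k n m) : φ.not.Realize N a b ↔ ¬ φ.Realize N a b :=
  Iff.rfl

theorem realize_and (φ ψ : Formula L ι k n m) :
    (φ.and ψ).Realize N a b ↔ φ.Realize N a b ∧ ψ.Realize N a b := by
  simp [Formula.and, realize_not, Realize]

theorem realize_conj (l : List (Formula L ι k n m)) :
    (conj l).Realize N a b ↔ ∀ φ ∈ l, φ.Realize N a b := by
  induction l with
  | nil => simp [conj, realize_not, Realize]
  | cons φ l ih =>
    rw [List.forall_mem_cons, ← ih]
    exact realize_and N a b φ (conj l)

theorem realize_iInf {β : Type*} [Finite β] (φ : β → Formula L ι k n m) :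
    (iInf φ).Realize N a b ↔ ∀ i, (φ i).Realize N a b := by
  simp [iInf, realize_conj]

theorem realize_exP (φ : Formula L ι k (n + 1) m) :
    φ.exP.Realize N a b ↔ ∃ p : N.P, φ.Realize N (Fin.snoc a p) b := by
  simp [exP, realize_not, Realize]

theorem realize_closeP {n : ℕ} (φ : Formula L ι k n m) (a₀ : Fin 0 → N.P) :
    φ.closeP.Realize N a₀ b ↔ ∀ a : Fin n → N.P, φ.Realize N a b := by
  induction n with
  | zero => exact ⟨fun h a => Subsingleton.elim a₀ a ▸ h, fun h => h a₀⟩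
  | succ n ih =>
    rw [closeP, ih]
    exact ⟨fun h a => Fin.snoc_init_self a ▸ h (Fin.init a) (a (Fin.last n)), fun h a p => h _⟩

theorem realize_closeM {m : ℕ} (φ : Formula L ι k n m) (b₀ : Fin 0 → N.M) :
    φ.closeM.Realize N a b₀ ↔ ∀ b : Fin m → N.M, φ.Realize N a b := by
  induction m with
  | zero => exact ⟨fun h b => Subsingleton.elim b₀ b ▸ h, fun h => h b₀⟩
  | succ m ih =>
    rw [closeM, ih]
    exact ⟨fun h b => Fin.snoc_init_self b ▸ h (Fin.init b) (b (Fin.last m)), fun h b c => h _⟩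

end Formula

theorem IsReduced.not {φ : Formula L ι k n m} (h : IsReduced φ) : IsReduced φ.not :=
  h.imp .falsum

theorem IsReduced.and {φ ψ : Formula L ι k n m} (h : IsReduced φ) (h' : IsReduced ψ) :
    IsReduced (φ.and ψ) :=
  (h.imp h'.not).not

theorem IsReduced.iInf {β : Type*} [Finite β] {φ : β → Formula L ι k n m}
    (h : ∀ i, IsReduced (φ i)) : IsReduced (Formula.iInf φ) := by
  have key : ∀ l : List (Formula L ι k n m), (∀ φ ∈ l, IsReduced φ) →
      IsReduced (Formula.conj l) := by
    intro l hl
    induction l with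
    | nil => exact IsReduced.falsum.not
    | cons φ l ih =>
      exact (hl φ (by simp)).and (ih fun ψ hψ => hl ψ (by simp [hψ]))
  refine key _ fun ψ hψ => ?_
  obtain ⟨i, -, rfl⟩ := List.mem_map.1 hψ
  exact h i

theorem realize_substTerm (N : Struct.{u, v, w, x} L ι k) {d l : ℕ} (s : Fin d → ι)
    (e : Fin d → Fin k → Fin n) (a : Fin n → N.P) (b : Fin (m + l) → N.M)
    (t : L.Term ((Fin d ⊕ Fin m) ⊕ Fin l)) :
    (substTerm s e t).realize N a b = t.realize (Sum.elim
      (Sum.elim (fun j => N.f (s j) fun r => a (e j r)) fun j => b (Fin.castAdd l j))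
      fun j => b (Fin.natAdd m j)) := by
  induction t with
  | var j => rcases j with (j | j) | j <;> rfl
  | func g ts ih =>
    rw [substTerm, Term.realize, FirstOrder.Language.Term.realize_func]
    simp only [ih]

theorem realize_substFormula_bounded (N : Struct.{u, v, w, x} L ι k) {d l : ℕ} (s : Fin d → ι)
    (e : Fin d → Fin k → Fin n) (a : Fin n → N.P) (b : Fin (m + l) → N.M)
    (θ : L.BoundedFormula (Fin d ⊕ Fin m) l) :
    (substFormula s e θ).Realize N a b ↔ θ.Realize
      (Sum.elim (fun j => N.f (s j) fun r => a (e j r)) fun j => b (Fin.castAdd l j))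
      fun j => b (Fin.natAdd m j) := by
  induction θ with
  | falsum => rfl
  | equal t₁ t₂ =>
    rw [substFormula, Formula.Realize, realize_substTerm, realize_substTerm]
    rfl
  | rel R ts =>
    rw [substFormula, Formula.Realize]
    simp only [realize_substTerm]
    rfl
  | imp φ ψ ih₁ ih₂ =>
    rw [substFormula, Formula.Realize, ih₁, ih₂]
    rfl
  | @all l φ ih =>
    rw [substFormula, Formula.Realize, FirstOrder.Language.BoundedFormula.realize_all]
    refine forall_congr' fun c => (ih _).trans ?_
    refine iff_of_eq (congrArg₂ _ ?_ ?_)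
    · congr 1
      funext j
      exact Fin.snoc_castSucc (α := fun _ => N.M) c b (Fin.castAdd l j)
    · funext j
      refine Fin.lastCases ?_ (fun j => ?_) j
      · rw [Fin.snoc_last]
        exact Fin.snoc_last (α := fun _ => N.M) c b
      · rw [Fin.snoc_castSucc]
        exact Fin.snoc_castSucc (α := fun _ => N.M) c b (Fin.natAdd m j)

theorem realize_substFormula (N : Struct.{u, v, w, x} L ι k) {d : ℕ} (s : Fin d → ι)
    (e : Fin d → Fin k → Fin n) (a : Fin n → N.P) (b : Fin m → N.M)
    (θ : L.Formula (Fin d ⊕ Fin m)) :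
    (substFormula s e θ : Formula L ι k n m).Realize N a b ↔
      θ.Realize (Sum.elim (fun j => N.f (s j) fun r => a (e j r)) b) := by
  refine (realize_substFormula_bounded N s e a b θ).trans ?_
  exact iff_of_eq (congrArg _ (Subsingleton.elim _ _))

end Connectives

/-! ### Axiomatization of the two classes -/

section Axioms

variable {L : FirstOrder.Language.{u, v}} {ι : Type w} {k n m : ℕ}

/-- A sentence of `L` as a sentence of the two-sorted language. -/
def ofSentence (ι : Type w) (k : ℕ) (σ : L.Sentence) : Sentence L ι k :=
  substFormula (d := 0) (m := 0) Fin.elim0 Fin.elim0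
    (FirstOrder.Language.Formula.relabel Empty.elim σ)

theorem realize_ofSentence (N : Struct.{u, v, w, x} L ι k) (σ : L.Sentence)
    (a : Fin 0 → N.P) (b : Fin 0 → N.M) : (ofSentence ι k σ).Realize N a b ↔ N.M ⊨ σ := by
  refine (realize_substFormula N _ _ a b _).trans ?_
  rw [FirstOrder.Language.Formula.realize_relabel, FirstOrder.Language.Sentence.Realize]
  exact iff_of_eq (congrArg _ (Subsingleton.elim _ _))

/-- Over `n` distinct points, there is a new point at which the functions in `I` take the values
prescribed by `c` and the variables of sort `M`. -/
noncomputable def extensionAxiom (L : FirstOrder.Language.{u, v}) (I : Finset ι)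
    (c : I → (Fin k → Fin (n + 1)) → Fin m) : Sentence L ι k :=
  Formula.closeM <| Formula.closeP <| Formula.imp
    (Formula.iInf fun q : {q : Fin n × Fin n // q.1 ≠ q.2} => (Formula.eqP q.1.1 q.1.2).not)
    (Formula.exP <| Formula.and
      (Formula.iInf fun j : Fin n => (Formula.eqP j.castSucc (Fin.last n)).not)
      (Formula.iInf fun q : I × {e : Fin k → Fin (n + 1) // ∃ r, e r = Fin.last n} =>
        Formula.eqM (.app q.1 q.2.1) (.var (c q.1 q.2))))

theorem realize_extensionAxiom (N : Struct.{u, v, w, x} L ι k) (I : Finset ι)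
    (c : I → (Fin k → Fin (n + 1)) → Fin m) (a₀ : Fin 0 → N.P) (b₀ : Fin 0 → N.M) :
    (extensionAxiom L I c).Realize N a₀ b₀ ↔
      ∀ (b : Fin m → N.M) (a : Fin n → N.P), Function.Injective a → ∃ p, (∀ j, a j ≠ p) ∧
        ∀ (i : I) (e : Fin k → Fin (n + 1)), (∃ r, e r = Fin.last n) →
          N.f i (fun r => (Fin.snoc a p : Fin (n + 1) → N.P) (e r)) = b (c i e) := by
  rw [extensionAxiom, Formula.realize_closeM]
  refine forall_congr' fun b => ?_
  rw [Formula.realize_closeP]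
  refine forall_congr' fun a => imp_congr ?_ ?_
  · rw [Formula.realize_iInf]
    constructor
    · intro h i j hij
      by_contra hne
      exact h ⟨(i, j), hne⟩ hij
    · exact fun h q hq => q.2 (h hq)
  · rw [Formula.realize_exP]
    refine exists_congr fun p => ?_
    rw [Formula.realize_and, Formula.realize_iInf, Formula.realize_iInf]
    refine and_congr (forall_congr' fun j => ?_) ?_
    · rw [Formula.realize_not, Formula.Realize, Fin.snoc_last, Fin.snoc_castSucc]
    · exact ⟨fun h i e he => h (i, ⟨e, he⟩), fun h q => h q.1 q.2.1 q.2.2⟩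

theorem onePointExtension_iff (N : Struct.{u, v, w, x} L ι k) :
    OnePointExtension N.f ↔ ∀ (I : Finset ι) (n m : ℕ)
      (c : I → (Fin k → Fin (n + 1)) → Fin m),
        (extensionAxiom L I c).Realize N Fin.elim0 Fin.elim0 := by
  classical
  simp only [realize_extensionAxiom]
  constructor
  · intro h I n m c b a ha
    obtain ⟨p, hp, hv⟩ := h I n a ha fun i e => if hi : i ∈ I then b (c ⟨i, hi⟩ e)
      else Classical.arbitrary _
    refine ⟨p, hp, fun i e he => ?_⟩
    simpa using hv i i.2 e he
  · intro h I n a ha w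
    -- One variable of sort `M` for each function and tuple, so that every prescription `w` is an
    -- instance.
    let eqv := Fintype.equivFin (I × (Fin k → Fin (n + 1)))
    obtain ⟨p, hp, hv⟩ := h I n _ (fun i e => eqv (i, e))
      (fun j => w (eqv.symm j).1 (eqv.symm j).2) a ha
    refine ⟨p, hp, fun i hi e he => ?_⟩
    simpa using hv ⟨i, hi⟩ e he

/-- Without functions, the extension axiom only says that `n` distinct points never exhaust `P`. -/
theorem infinite_iff (N : Struct.{u, v, w, x} L ι k) :
    Infinite N.P ↔ ∀ (n : ℕ),
      (extensionAxiom (n := n) (m := 0) (k := k) L (∅ : Finset ι)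
        fun i => absurd i.2 (Finset.notMem_empty _)).Realize N Fin.elim0 Fin.elim0 := by
  classical
  simp only [realize_extensionAxiom]
  constructor
  · intro _ n b a _
    obtain ⟨p, hp⟩ := Infinite.exists_notMem_finset (Finset.univ.image a)
    refine ⟨p, fun j h => hp (h ▸ Finset.mem_image_of_mem a (Finset.mem_univ j)), fun i => ?_⟩
    exact absurd i.2 (Finset.notMem_empty _)
  · intro h
    by_contra hfin
    rw [not_infinite_iff_finite] at hfin
    obtain ⟨n, ⟨eqv⟩⟩ := Finite.exists_equiv_fin N.P
    obtain ⟨p, hp, -⟩ := h n Fin.elim0 eqv.symm eqv.symm.injective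
    exact hp (eqv p) (eqv.symm_apply_apply p)

theorem OnePointExtension.infinite {N : Struct.{u, v, w, x} L ι k}
    (h : OnePointExtension N.f) : Infinite N.P :=
  (infinite_iff N).2 fun n => (onePointExtension_iff N).1 h ∅ n 0 _

variable {T : L.Theory}

/-- The defining conditions are expressed by sentences; these hold throughout the class, so they
belong to its theory. -/
theorem models_DMinus_iff (N : Struct.{u, v, w, max u v w} L ι k) :
    Models N (DMinus T ι k) ↔ Infinite N.P ∧ N.M ⊨ T := by
  refine ⟨fun h => ⟨?_, ?_⟩, fun h φ hφ => hφ N h⟩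
  · exact (infinite_iff N).2 fun n => h _ fun N' hN' => (infinite_iff N').1 hN'.1 n
  · refine (FirstOrder.Language.Theory.model_iff T).2 fun σ hσ => ?_
    refine (realize_ofSentence N σ Fin.elim0 Fin.elim0).1 (h _ fun N' hN' => ?_)
    exact (realize_ofSentence N' σ _ _).2
      ((FirstOrder.Language.Theory.model_iff T).1 hN'.2 σ hσ)

theorem models_D_iff (N : Struct.{u, v, w, max u v w} L ι k) :
    Models N (D T ι k) ↔ Infinite N.P ∧ N.M ⊨ T ∧ IsRich N.f := by
  refine ⟨fun h => ?_, fun h φ hφ => hφ N ⟨⟨h.1, h.2.1⟩, h.2.2⟩⟩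
  obtain ⟨h1, h2⟩ := (models_DMinus_iff (T := T) N).1 fun φ hφ => h φ fun N' hN' => hφ N' hN'.1
  refine ⟨h1, h2, OnePointExtension.isRich ((onePointExtension_iff N).2 fun I n m c => ?_)⟩
  exact h _ fun N' hN' => (onePointExtension_iff N').1 hN'.2.onePointExtension I n m c

theorem Models.onePointExtension {N : Struct.{u, v, w, max u v w} L ι k}
    (h : Models N (D T ι k)) : OnePointExtension N.f :=
  ((models_D_iff N).1 h).2.2.onePointExtension

theorem Models.model {N : Struct.{u, v, w, max u v w} L ι k}
    (h : Models N (D T ι k)) : N.M ⊨ T :=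
  ((models_D_iff N).1 h).2.1

theorem models_D_of_onePointExtension {N : Struct.{u, v, w, max u v w} L ι k}
    (h : OnePointExtension N.f) (hT : N.M ⊨ T) : Models N (D T ι k) :=
  (models_D_iff N).2 ⟨h.infinite, hT, h.isRich⟩

end Axioms

/-! ### Reduced formulas, completeness and model companion -/

section Main

variable {L : FirstOrder.Language.{u, v}} {ι : Type w} {k : ℕ} {T : L.Theory}

/-- An `L`-formula in the values of the functions at the tuples of `a ∘ s` is a reduced formula. -/
theorem exists_isReduced_of_valuation {n n' m : ℕ} (s : Fin n' → Fin n)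
    (θ : L.Formula ((ι × (Fin k → Fin n')) ⊕ Fin m)) :
    ∃ ψ : Formula L ι k n m, IsReduced ψ ∧ ∀ (N : Struct.{u, v, w, x} L ι k)
      (a : Fin n → N.P) (b : Fin m → N.M),
        ψ.Realize N a b ↔ θ.Realize (valuation N (fun j => a (s j)) b) := by
  -- The swap puts the function values on the right, where all but finitely many are discarded;
  -- those left give `d`.
  obtain ⟨S, θ', h⟩ := exists_finite_inr.{u, v, x} (α := Fin m) (θ.relabel Sum.swap)
  obtain ⟨d, ⟨eqv⟩⟩ := Finite.exists_equiv_fin S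
  refine ⟨_, IsReduced.subst (fun j => (eqv.symm j).1.1) (fun j r => s ((eqv.symm j).1.2 r))
    (θ'.relabel (Sum.elim Sum.inr fun q => Sum.inl (eqv q))), fun N a b => ?_⟩
  rw [realize_substFormula, FirstOrder.Language.Formula.realize_relabel]
  have h1 := h N.M b fun q => N.f q.1 fun r => a (s (q.2 r))
  rw [FirstOrder.Language.Formula.realize_relabel] at h1
  refine Iff.trans (iff_of_eq (congrArg _ (funext ?_)))
    (h1.trans (iff_of_eq (congrArg _ (funext ?_))))
  · rintro (j | q) <;> simp
  · rintro (q | j) <;> rfl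

/-- In structures with the one-point extension property, every formula is equivalent to a reduced
formula. -/
theorem exists_isReduced {n m : ℕ} (φ : Formula L ι k n m) :
    ∃ ψ : Formula L ι k n m, IsReduced ψ ∧ ∀ N : Struct.{u, v, w, x} L ι k,
      OnePointExtension N.f → ∀ (a : Fin n → N.P) (b : Fin m → N.M),
        φ.Realize N a b ↔ ψ.Realize N a b := by
  -- A pattern sorts the variables into `n'` classes and picks a representative of each; `χ` says
  -- that the variables coincide exactly as the pattern prescribes.
  let Pat := Σ n' : Fin (n + 1), (Fin n → Fin n') × (Fin n' → Fin n)
  choose θ hθ using fun q : Pat => exists_elimination.{u, v, w, x} φ q.2.1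
  choose ψ hψ hψ' using fun q : Pat => exists_isReduced_of_valuation.{u, v, w, x} q.2.2 (θ q)
  let χ (q : Pat) : Formula L ι k n m :=
    (Formula.iInf fun i : Fin n => Formula.eqP i (q.2.2 (q.2.1 i))).and
      (Formula.iInf fun r : {r : Fin q.1 × Fin q.1 // r.1 ≠ r.2} =>
        (Formula.eqP (q.2.2 r.1.1) (q.2.2 r.1.2)).not)
  refine ⟨Formula.iInf fun q => (χ q).imp (ψ q), IsReduced.iInf fun q =>
    ((IsReduced.iInf fun _ => .eqP _ _).and (IsReduced.iInf fun _ => (IsReduced.eqP _ _).not)).imp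
      (hψ q), fun N hN a b => ?_⟩
  have hχ (q : Pat) : (χ q).Realize N a b ↔ (∀ i, a i = a (q.2.2 (q.2.1 i))) ∧
      Function.Injective fun j => a (q.2.2 j) := by
    rw [Formula.realize_and, Formula.realize_iInf, Formula.realize_iInf]
    refine and_congr Iff.rfl ⟨fun h i j hij => ?_, fun h r hr => r.2 (h hr)⟩
    by_contra hne
    exact h ⟨(i, j), hne⟩ hij
  have key (q : Pat) (hq : (χ q).Realize N a b) : φ.Realize N a b ↔ (ψ q).Realize N a b := by
    obtain ⟨h1, h2⟩ := (hχ q).1 hq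
    rw [hψ' q, ← hθ q N hN _ h2 b]
    exact iff_of_eq (congrArg (fun z => φ.Realize N z b) (funext h1))
  rw [Formula.realize_iInf]
  refine ⟨fun h q hq => (key q hq).1 h, fun h => ?_⟩
  have hcard : Nat.card (Set.range a) ≤ n := by
    simpa using Finite.card_range_le a
  let eqv := Finite.equivFin (Set.range a)
  -- The pattern of `a` itself, with one class for each point in its range.
  let q : Pat := ⟨⟨Nat.card (Set.range a), Nat.lt_succ_of_le hcard⟩,
    fun i => eqv ⟨a i, i, rfl⟩, fun j => (eqv.symm j).2.choose⟩
  have hs (j : Fin (Nat.card (Set.range a))) : a (eqv.symm j).2.choose = (eqv.symm j).1 :=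
    (eqv.symm j).2.choose_spec
  have hq : (χ q).Realize N a b := by
    refine (hχ q).2 ⟨fun i => ?_, fun i j hij => ?_⟩
    · exact ((hs (eqv ⟨a i, i, rfl⟩)).trans (by rw [Equiv.symm_apply_apply])).symm
    · exact eqv.symm.injective (Subtype.ext ((hs i).symm.trans (hij.trans (hs j))))
  exact (key q hq).2 (h q hq)

theorem exists_isReduced_equivModulo (T : L.Theory) {n m : ℕ} (φ : Formula L ι k n m) :
    ∃ ψ : Formula L ι k n m, IsReduced ψ ∧ EquivModulo (D T ι k) φ ψ := by
  obtain ⟨ψ, hψ, h⟩ := exists_isReduced φ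
  exact ⟨ψ, hψ, fun N hN => h N hN.onePointExtension⟩

theorem IsReduced.realize_iff {n m : ℕ} {φ : Formula L ι k n m} (hφ : IsReduced φ)
    {A B : Struct.{u, v, w, x} L ι k} (η : Embedding A B) (g : A.M ↪ₑ[L] B.M)
    (hg : ∀ c, g c = η.toM c) (a : Fin n → A.P) (b : Fin m → A.M) :
    φ.Realize A a b ↔ φ.Realize B (fun i => η.toP (a i)) (fun j => η.toM (b j)) := by
  induction hφ with
  | falsum => rfl
  | eqP i j => exact η.toP.injective.eq_iff.symm
  | subst s e θ =>
    rw [realize_substFormula, realize_substFormula, ← g.map_formula]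
    refine iff_of_eq (congrArg _ (funext ?_))
    rintro (j | j)
    · simp [hg, η.map_f]
    · simp [hg]
  | imp _ _ ih₁ ih₂ => exact imp_congr ih₁ ih₂

theorem isElementary_of_elementaryEmbedding {A B : Struct.{u, v, w, max u v w} L ι k}
    (hA : Models A (D T ι k)) (hB : Models B (D T ι k)) (η : Embedding A B) (g : A.M ↪ₑ[L] B.M)
    (hg : ∀ c, g c = η.toM c) : η.IsElementary := by
  intro n m φ a b
  obtain ⟨ψ, hψ, h⟩ := exists_isReduced_equivModulo T φ
  rw [h A hA, h B hB, hψ.realize_iff η g hg]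

/-- Only `P` grows, so the `M`-sort remains a model of `T`; the extension property makes the new `P`
infinite. -/
theorem exists_embedding_models_D {A : Struct.{u, v, w, max u v w} L ι k} (hA : A.M ⊨ T) :
    ∃ B : Struct.{u, v, w, max u v w} L ι k, Models B (D T ι k) ∧ Nonempty (Embedding A B) := by
  let B : Struct.{u, v, w, max u v w} L ι k :=
    { P := RichExtension.{w, max u v w} A.P A.M ι k
      M := A.M
      nonemptyP := ⟨.base (Classical.arbitrary A.P)⟩
      f := RichExtension.fn A.f }
  refine ⟨B, models_D_of_onePointExtension (RichExtension.onePointExtension_fn A.f) hA, ⟨?_⟩⟩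
  exact
    { toP := ⟨RichExtension.base, fun _ _ h => RichExtension.base.inj h⟩
      toM := FirstOrder.Language.Embedding.refl L A.M
      map_f := fun i p => (RichExtension.fn_base A.f i p).symm }

theorem isComplete_D (hk : 1 ≤ k) (hT : T.IsComplete) : IsComplete (D T ι k) := by
  constructor
  · obtain ⟨M⟩ := hT.1
    let M' : FirstOrder.Language.Theory.ModelType.{u, v, max u v w} T :=
      FirstOrder.Language.Theory.ModelType.ulift.{u, v, max u v, w} M
    obtain ⟨B, hB, -⟩ := exists_embedding_models_D (T := T)
      -- One point suffices as a seed for the free construction.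
      (A := { P := PUnit, M := M', f := fun (_ : ι) (_ : Fin k → PUnit) => Classical.arbitrary M' })
      M'.is_model
    exact ⟨B, hB⟩
  · intro φ
    obtain ⟨θ, hθ⟩ := exists_elimination.{u, v, w, max u v w} φ (Fin.elim0 : Fin 0 → Fin 0)
    -- Since `k ≥ 1`, there is no `k`-tuple from `Fin 0`, so `θ` has no variables at all.
    let σ : L.Sentence := FirstOrder.Language.Formula.relabel
      (Sum.elim (fun q => (q.2 ⟨0, hk⟩).elim0) fun j => j.elim0) θ
    have h (N : Struct.{u, v, w, max u v w} L ι k) (hN : Models N (D T ι k)) :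
        φ.Realize N Fin.elim0 Fin.elim0 ↔ N.M ⊨ σ := by
      have h1 := hθ N hN.onePointExtension Fin.elim0 (fun i => i.elim0) Fin.elim0
      rw [FirstOrder.Language.Sentence.Realize, FirstOrder.Language.Formula.realize_relabel]
      refine Iff.trans (iff_of_eq (congrArg (fun z => φ.Realize N z Fin.elim0)
        (Subsingleton.elim _ _))) (h1.trans (iff_of_eq (congrArg _ (funext ?_))))
      rintro (q | j)
      · exact (q.2 ⟨0, hk⟩).elim0
      · exact j.elim0
    rcases hT.2 σ with hσ | hσ
    · refine Or.inl fun N hN => (h N hN).2 ?_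
      have := hN.model
      exact hσ.realize_sentence N.M
    · refine Or.inr fun N hN hφ => ?_
      have := hN.model
      exact (FirstOrder.Language.Sentence.realize_not N.M).1 (hσ.realize_sentence N.M)
        ((h N hN).1 hφ)

theorem isQF_substFormula {n m d l : ℕ} (s : Fin d → ι) (e : Fin d → Fin k → Fin n)
    {θ : L.BoundedFormula (Fin d ⊕ Fin m) l} (hθ : θ.IsQF) : (substFormula s e θ).IsQF := by
  induction hθ with
  | falsum => exact .falsum
  | of_isAtomic h =>
    cases h with
    | equal t₁ t₂ => exact .eqM _ _
    | rel R ts => exact .rel R _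
  | imp _ _ ih₁ ih₂ => exact .imp ih₁ ih₂

theorem TheoryHasQE.exists_isQF (hQE : TheoryHasQE T) {α : Type*} [Finite α] (θ : L.Formula α) :
    ∃ θ' : L.Formula α, FirstOrder.Language.BoundedFormula.IsQF θ' ∧
      ∀ (M : Type x) [L.Structure M] [Nonempty M], M ⊨ T → ∀ c : α → M,
        θ.Realize c ↔ θ'.Realize c := by
  let eqv := Finite.equivFin α
  obtain ⟨ψ, hψ, h⟩ := hQE _ (θ.relabel eqv)
  refine ⟨ψ.relabel eqv.symm, hψ.relabel _, fun M _ _ hM c => ?_⟩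
  have h1 := FirstOrder.Language.Theory.Iff.realize_iff (M := M) h (v := c ∘ eqv.symm)
  rw [FirstOrder.Language.Formula.realize_relabel] at h1
  rw [FirstOrder.Language.Formula.realize_relabel, ← h1, Function.comp_assoc,
    Equiv.symm_comp_self, Function.comp_id]

theorem TheoryHasQE.hasQE_D (hQE : TheoryHasQE T) : HasQE (D T ι k) := by
  intro n m φ
  obtain ⟨ψ, hψ, h⟩ := exists_isReduced_equivModulo T φ
  suffices ∃ χ : Formula L ι k n m, χ.IsQF ∧ EquivModulo (D T ι k) ψ χ by
    obtain ⟨χ, hχ, h'⟩ := this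
    exact ⟨χ, hχ, fun N hN a b => (h N hN a b).trans (h' N hN a b)⟩
  clear h
  induction hψ with
  | falsum => exact ⟨_, .falsum, fun _ _ _ _ => Iff.rfl⟩
  | eqP i j => exact ⟨_, .eqP i j, fun _ _ _ _ => Iff.rfl⟩
  | subst s e θ =>
    obtain ⟨θ', hθ', h⟩ := hQE.exists_isQF.{u, v, max u v w} θ
    refine ⟨_, isQF_substFormula s e hθ', fun N hN a b => ?_⟩
    exact (realize_substFormula N s e a b θ).trans
      ((h N.M hN.model _).trans (realize_substFormula N s e a b θ').symm)
  | imp _ _ ih₁ ih₂ =>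
    obtain ⟨χ₁, hχ₁, h₁⟩ := ih₁
    obtain ⟨χ₂, hχ₂, h₂⟩ := ih₂
    exact ⟨_, hχ₁.imp hχ₂, fun N hN a b => imp_congr (h₁ N hN a b) (h₂ N hN a b)⟩

/-- Embeddings preserve and reflect quantifier-free formulas, and modulo `T` there are no others. -/
theorem TheoryHasQE.exists_elementaryEmbedding (hQE : TheoryHasQE T) {M M' : Type x}
    [L.Structure M] [L.Structure M'] [Nonempty M] [Nonempty M'] (hM : M ⊨ T) (hM' : M' ⊨ T)
    (η : M ↪[L] M') : ∃ g : M ↪ₑ[L] M', ∀ c, g c = η c := by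
  refine ⟨⟨η, fun n φ c => ?_⟩, fun c => rfl⟩
  obtain ⟨ψ, hψ, h⟩ := hQE.exists_isQF.{u, v, x} φ
  rw [h M hM, h M' hM']
  have key := hψ.realize_embedding η (v := c) (xs := default)
  rwa [Subsingleton.elim (η ∘ default : Fin 0 → M') default] at key

theorem TheoryHasQE.isModelCompanion_D (hQE : TheoryHasQE T) :
    IsModelCompanion (D T ι k) (DMinus T ι k) := by
  refine ⟨fun A B hA hB η => ?_, fun A hA => ?_, fun A hA => ⟨A, ?_, ⟨?_⟩⟩⟩
  · obtain ⟨g, hg⟩ := hQE.exists_elementaryEmbedding hA.model hB.model η.toM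
    exact isElementary_of_elementaryEmbedding hA hB η g hg
  · exact exists_embedding_models_D ((models_DMinus_iff A).1 hA).2
  · exact (models_DMinus_iff A).2 ⟨((models_D_iff A).1 hA).1, hA.model⟩
  · exact ⟨.refl _, .refl L A.M, fun _ _ => rfl⟩

end Main

end GenericFunctions

theorem mainTheorem2 {L : FirstOrder.Language.{u, v}} {ι : Type w} [Nonempty ι] {k : ℕ} (hk : 1 ≤ k)
    (T : L.Theory) (hT : T.IsComplete)
    (hT2 : ∃ M : FirstOrder.Language.Theory.ModelType.{u, v, max u v} T, Nontrivial M) :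
    -- the two classes of structures are elementary, with the expected models
    (∀ N : GenericFunctions.Struct.{u, v, w, max u v w} L ι k,
      (GenericFunctions.Models N (GenericFunctions.DMinus T ι k) ↔
        Infinite N.P ∧ N.M ⊨ T) ∧
      (GenericFunctions.Models N (GenericFunctions.D T ι k) ↔
        Infinite N.P ∧ N.M ⊨ T ∧ GenericFunctions.IsRich N.f)) ∧
    -- the case that `T` has quantifier elimination
    (GenericFunctions.TheoryHasQE T →
      GenericFunctions.IsModelCompanion (GenericFunctions.D T ι k)
        (GenericFunctions.DMinus T ι k) ∧
      GenericFunctions.IsComplete (GenericFunctions.D T ι k) ∧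
      GenericFunctions.HasQE (GenericFunctions.D T ι k)) ∧
    -- arbitrary `T`
    GenericFunctions.IsComplete (GenericFunctions.D T ι k) ∧
    (∀ (n m : ℕ) (φ : GenericFunctions.Formula L ι k n m),
      ∃ ψ : GenericFunctions.Formula L ι k n m,
        GenericFunctions.IsReduced ψ ∧
        GenericFunctions.EquivModulo (GenericFunctions.D T ι k) φ ψ) ∧
    (∀ A B : GenericFunctions.Struct.{u, v, w, max u v w} L ι k,
      GenericFunctions.Models A (GenericFunctions.D T ι k) →
      GenericFunctions.Models B (GenericFunctions.D T ι k) →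
      ∀ (η : GenericFunctions.Embedding A B) (g : A.M ↪ₑ[L] B.M),
        (∀ c : A.M, g c = η.toM c) → η.IsElementary) := by
  exact ⟨fun N => ⟨GenericFunctions.models_DMinus_iff N, GenericFunctions.models_D_iff N⟩,
    fun hQE => ⟨hQE.isModelCompanion_D, GenericFunctions.isComplete_D hk hT, hQE.hasQE_D⟩,
    GenericFunctions.isComplete_D hk hT,
    fun _ _ φ => GenericFunctions.exists_isReduced_equivModulo T φ,
    fun _ _ hA hB η g hg =>
      GenericFunctions.isElementary_of_elementaryEmbedding hA hB η g hg⟩
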